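/- Write $\log$ for the binary logarithm. Fix a universal machine $U$ that takes a binary program $p$ and an auxiliary input $y$ (the program $1^i0q$ runs the $i$-th partial recursive function on $\langle q,y\rangle$), and let $C(x\mid y)=\min\{|p| : U(p,y)=x\}$ be conditional Kolmogorov complexity. For a labeled graph $G$ on the nodes $1,\dots,n$, let $E(G)\in\{0,1\}^{n(n-1)/2}$ be the characteristic string of its edge set, with the possible edges $\{u,v\}$, $u<v$, in lexicographic order; $G$ is called $d$-random if $C(E(G)\mid n,d)\ge n(n-1)/2-d$. A port assignment of $G$ connects, at every node $u$, the edges incident to $u$ bijectively to ports labeled $1,\dots,\deg u$. A routing scheme stores at every node $u$ a binary string $F(u)$, the encoding of the local routing function of $u$; it is a program for $U$ which, given only the label of a destination $v\ne u$, returns the label of a port of $u$, over which a message for $v$ is then forwarded. In particular, neither the neighbours of $u$ nor the port assignment are known to $u$ for free. It is a shortest-path routing scheme if any two nodes $u,v$ are connected and the route that it produces from $u$ to $v$ has length $\operatorname{dist}_G(u,v)$. **Theorem.** Let $\delta:\mathbb N\to\mathbb N$ with $\delta(n)=O(\log n)$. There is a function $\varepsilon:\mathbb N\to\mathbb R$ with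 $\varepsilon(n)\to0$ as $n\to\infty$, depending only on $\delta$ (and $U$), such that for all sufficiently large $n$, every $\delta(n)$-random labeled graph $G$ on $n$ nodes and every port assignment of $G$ (neither the labels nor the port assignment may be changed), there is a shortest-path routing scheme $F$ for $G$ with $$|F(u)|\le \frac n2\log n\,(1+\varepsilon(n))\quad\text{for every node }u,\qquad\text{and hence}\qquad \sum_u |F(u)|\le\frac{n^2}2\log n\,(1+\varepsilon(n)).$$ -/

import Mathlib

open Filter Topology Asymptotics

namespace CompactRouting

/-- The reference universal machine, with a binary program `p` and an auxiliary input `y`.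
A program of the form `1^i 0 q` runs the `i`-th partial recursive function (in Mathlib's standard
enumeration of codes) on the input `⟨q, y⟩`; a program containing no `0` never halts. -/
def universalMachine (p : List Bool) (y : ℕ) : Part ℕ :=
  match p.dropWhile id with
  | [] => Part.none
  | _ :: q =>
      (Denumerable.ofNat Nat.Partrec.Code (p.takeWhile id).length).eval (Encodable.encode (q, y))

/-- The machine is universal: every partial recursive function of a program and an auxiliary input
is simulated by it, at the cost of a constant-length prefix. -/
theorem universalMachine_universal (f : List Bool × ℕ →. ℕ) (hf : Partrec f) :
    ∃ s : List Bool, ∀ (q : List Bool) (y : ℕ), universalMachine (s ++ q) y = f (q, y) := by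
  obtain ⟨c, hc⟩ := Nat.Partrec.Code.exists_code.1 hf
  refine ⟨List.replicate (Encodable.encode c) true ++ [false], fun q y => ?_⟩
  have h1 : ((List.replicate (Encodable.encode c) true ++ [false]) ++ q).dropWhile id
      = false :: q := by
    rw [List.append_assoc, List.dropWhile_append_of_pos (by simp)]
    simp
  have h2 : ((List.replicate (Encodable.encode c) true ++ [false]) ++ q).takeWhile id
      = List.replicate (Encodable.encode c) true := by
    rw [List.append_assoc, List.takeWhile_append_of_pos (by simp)]
    simp
  unfold universalMachine
  rw [h1, h2]
  simp only [Denumerable.ofNat_encode, List.length_replicate, hc, Encodable.encodek,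
    Part.coe_some, Part.bind_some]
  exact Part.map_id' (fun _ => rfl) _

/-- Conditional Kolmogorov complexity `C(x | y)`: the length of a shortest program that makes
the universal machine print the string `x` when it is given `y`. -/
noncomputable def condComplexity (x : List Bool) (y : ℕ) : ℕ :=
  sInf {k | ∃ p : List Bool, p.length = k ∧ Encodable.encode x ∈ universalMachine p y}

/-- The minimum in the definition of `condComplexity` is attained. -/
theorem exists_program (x : List Bool) (y : ℕ) :
    ∃ p : List Bool, p.length = condComplexity x y ∧
      Encodable.encode x ∈ universalMachine p y := by
  obtain ⟨s, hs⟩ := universalMachine_universal (fun _ => Part.some (Encodable.encode x))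
    (Computable.const (Encodable.encode x)).partrec
  exact Nat.sInf_mem (s := {k | ∃ p : List Bool, p.length = k ∧
      Encodable.encode x ∈ universalMachine p y})
    ⟨_, s ++ [], rfl, by rw [hs]; exact Part.mem_some _⟩

open Classical in
/-- The standard encoding `E(G)` of a labeled graph on `n` nodes: the characteristic string of the
edge set, with the `n (n - 1) / 2` possible edges `{u, v}`, `u < v`, in lexicographic order. -/
noncomputable def graphCode {n : ℕ} (G : SimpleGraph (Fin n)) : List Bool :=
  (List.finRange n).flatMap fun u =>
    ((List.finRange n).filter fun v => u < v).map fun v => decide (G.Adj u v)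

/-- A labeled graph on `n` nodes is `d`-random (has randomness deficiency at most `d`) in the family
of all labeled graphs on `n` nodes: `C(E(G) | n, d) ≥ n (n - 1) / 2 - d`. -/
def IsRandomGraph {n : ℕ} (d : ℕ) (G : SimpleGraph (Fin n)) : Prop :=
  n * (n - 1) / 2 ≤ condComplexity (graphCode G) (Nat.pair n d) + d

/-- The label in `{1, …, n}` of a node. -/
def nodeLabel {n : ℕ} (v : Fin n) : ℕ := (v : ℕ) + 1

/-- A port assignment: at every node `u`, the incident edges (that is, the neighbours of `u`) are
connected bijectively to `deg u` ports. -/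
abbrev PortAssignment {n : ℕ} (G : SimpleGraph (Fin n)) : Type :=
  ∀ u : Fin n, G.neighborSet u ≃ Fin (Nat.card (G.neighborSet u))

/-- The label in `{1, …, deg u}` of the port of `u` that leads to its neighbour `w`. -/
def portLabel {n : ℕ} {G : SimpleGraph (Fin n)} (π : PortAssignment G) (u : Fin n)
    (w : G.neighborSet u) : ℕ := (π u w : ℕ) + 1

/-- A routing scheme stores a binary string `F u` at every node `u`, as the encoding of the local
routing function of `u`. This is a program that receives nothing but the label of the destination
`v` and returns the label of a port of `u`. `Forwards π F v u w` says that the local routing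
function at `u` sends a message for `v` over the edge from `u` to its neighbour `w`. -/
def Forwards {n : ℕ} {G : SimpleGraph (Fin n)} (π : PortAssignment G) (F : Fin n → List Bool)
    (v u w : Fin n) : Prop :=
  ∃ h : w ∈ G.neighborSet u, portLabel π u ⟨w, h⟩ ∈ universalMachine (F u) (nodeLabel v)

/-- `Route π F v u k`: the route that the scheme `F` produces from `u` reaches the destination `v`
after traversing exactly `k` edges. -/
inductive Route {n : ℕ} {G : SimpleGraph (Fin n)} (π : PortAssignment G)
    (F : Fin n → List Bool) (v : Fin n) : Fin n → ℕ → Prop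
  | arrived : Route π F v v 0
  | step {u w : Fin n} {k : ℕ} : u ≠ v → Forwards π F v u w → Route π F v w k →
      Route π F v u (k + 1)

/-- The scheme `F` is a shortest-path routing scheme for `G` with port assignment `π`: between any
two nodes it produces a route, and this route is a shortest path. -/
def IsShortestPathRouting {n : ℕ} {G : SimpleGraph (Fin n)} (π : PortAssignment G)
    (F : Fin n → List Bool) : Prop :=
  ∀ u v : Fin n, G.Reachable u v ∧ Route π F v u (G.dist u v)

end CompactRouting

/-!
A graph is called typical here if all its degrees are at most `n / 2 * (1 + 1 / L)`, where
`L = ⌊log n⌋`, and if any two nodes have a common neighbour among the first `M = L * (L + δ)` nodes.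
In the uniform random graph, Hoeffding's inequality bounds the degrees, and the events that `w` is a
common neighbour of `u` and `v` are independent for different `w` and of probability `1 / 4`. So
for every constant `c` the fraction of atypical graphs is at most `2 ^ (-(δ + c))` if `n` is large.
Being typical is decidable, so an atypical graph is determined, given `n` and `δ`, by its index in
an enumeration of the atypical graphs. This is a description of `n (n - 1) / 2 - δ - c + O(1)` bits,
which is too short for a `δ`-random graph once `c` exceeds the implied constant.

In a typical graph the distances are at most `2`. The routing table of `u` stores a port, in
`log n` bits, only for the `n / 2 * (1 + o(1))` neighbours of `u`; for any other destination it
stores a common neighbour among the first `M` nodes, which takes only `log M = o(log n)` bits, and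
whose port can be looked up in the same table.
-/

namespace CompactRouting

open MeasureTheory ProbabilityTheory unitInterval
open scoped SimpleGraph

section Bits

/-- The `k` least significant binary digits of `a`, least significant digit first. -/
def toBits (k a : ℕ) : List Bool := (List.range k).map a.testBit

/-- The number with the given binary digits, least significant digit first. -/
def ofBits (l : List Bool) : ℕ := l.foldr Nat.bit 0

@[simp] theorem length_toBits (k a : ℕ) : (toBits k a).length = k := by simp [toBits]

theorem testBit_ofBits (l : List Bool) (i : ℕ) : (ofBits l).testBit i = l.getD i false := by
  induction l generalizing i with
  | nil => simp [ofBits]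
  | cons b l ih =>
    cases i with
    | zero => simp [ofBits]
    | succ i => simpa [ofBits, Nat.testBit_bit_succ] using ih i

theorem ofBits_lt (l : List Bool) : ofBits l < 2 ^ l.length :=
  Nat.lt_pow_two_of_testBit _ fun i hi => by
    rw [testBit_ofBits, List.getD_eq_default _ _ hi]

theorem ofBits_toBits {k a : ℕ} (h : a < 2 ^ k) : ofBits (toBits k a) = a := by
  refine Nat.eq_of_testBit_eq fun i => ?_
  rw [testBit_ofBits]
  rcases lt_or_ge i k with hi | hi
  · rw [List.getD_eq_getElem _ _ (by simpa using hi)]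
    simp [toBits]
  · rw [List.getD_eq_default _ _ (by simpa using hi), Nat.testBit_eq_false_of_lt
      (h.trans_le (Nat.pow_le_pow_right two_pos hi))]

theorem toBits_ofBits (l : List Bool) : toBits l.length (ofBits l) = l :=
  List.ext_getElem (by simp) fun i _ hi => by
    simp [toBits, testBit_ofBits, List.getElem?_eq_getElem hi]

theorem primrec_pow : Primrec₂ fun a b : ℕ => a ^ b := Primrec₂.unpaired'.1 Nat.Primrec.pow

theorem primrec_testBit : Primrec₂ Nat.testBit := by
  have hdiv : Primrec₂ fun a i : ℕ => a / 2 ^ i % 2 :=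
    Primrec.nat_mod.comp
      (Primrec.nat_div.comp Primrec.fst (primrec_pow.comp (Primrec.const 2) Primrec.snd))
      (Primrec.const 2)
  exact (Primrec.eq.comp hdiv (Primrec.const 1)).decide.of_eq fun _ =>
    Nat.testBit_eq_decide_div_mod_eq.symm

theorem primrec_toBits : Primrec₂ toBits :=
  Primrec.list_map (Primrec.list_range.comp Primrec.fst)
    (primrec_testBit.comp (Primrec.snd.comp Primrec.fst) Primrec.snd).to₂

theorem primrec_ofBits : Primrec ofBits := by
  have hbit : Primrec₂ Nat.bit :=
    Primrec.cond Primrec.fst (Primrec.nat_double_succ.comp Primrec.snd)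
      (Primrec.nat_double.comp Primrec.snd)
  exact Primrec.list_foldr Primrec.id (Primrec.const 0) (hbit.comp₂
    (Primrec.fst.comp₂ Primrec₂.right) (Primrec.snd.comp₂ Primrec₂.right))

end Bits

section Complexity

theorem exists_condComplexity_le_of_mem {g : ℕ → List (List Bool)} (hg : Primrec g) :
    ∃ c : ℕ, ∀ y r : ℕ, (g y).length ≤ 2 ^ r → ∀ x ∈ g y, condComplexity x y ≤ r + c := by
  have hlookup : Primrec fun z : List Bool × ℕ => Encodable.encode ((g z.2).getD (ofBits z.1) []) :=
    Primrec.encode.comp ((Primrec.list_getD []).comp (hg.comp Primrec.snd)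
      (primrec_ofBits.comp Primrec.fst))
  obtain ⟨s, hs⟩ := universalMachine_universal _ hlookup.to_comp.partrec
  refine ⟨s.length, fun y r hr x hx => ?_⟩
  obtain ⟨i, hi, rfl⟩ := List.mem_iff_getElem.1 hx
  refine Nat.sInf_le ⟨s ++ toBits r i, by simp [add_comm], ?_⟩
  rw [hs]
  simp [ofBits_toBits (hi.trans_le hr), hi]

/-- The list of all bit strings of length `k`. -/
def bitStrings (k : ℕ) : List (List Bool) := (List.range (2 ^ k)).map (toBits k)

theorem mem_bitStrings {k : ℕ} {x : List Bool} : x ∈ bitStrings k ↔ x.length = k := by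
  rw [bitStrings, List.mem_map]
  constructor
  · rintro ⟨a, -, rfl⟩
    exact length_toBits k a
  · rintro rfl
    exact ⟨ofBits x, List.mem_range.2 (ofBits_lt x), toBits_ofBits x⟩

theorem nodup_bitStrings (k : ℕ) : (bitStrings k).Nodup :=
  List.Nodup.map_on (fun a ha b hb hab => by
    rw [← ofBits_toBits (List.mem_range.1 ha), hab, ofBits_toBits (List.mem_range.1 hb)])
    List.nodup_range

theorem primrec_bitStrings : Primrec bitStrings :=
  Primrec.list_map (Primrec.list_range.comp (primrec_pow.comp (Primrec.const 2) Primrec.id))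
    primrec_toBits

theorem exists_condComplexity_le_of_ncard {k : ℕ → ℕ} (hk : Primrec k)
    {p : ℕ → List Bool → Prop} (hp : PrimrecRel p) :
    ∃ c : ℕ, ∀ y r : ℕ, {x | x.length = k y ∧ p y x}.ncard ≤ 2 ^ r →
      ∀ x, x.length = k y → p y x → condComplexity x y ≤ r + c := by
  classical
  let g (y : ℕ) : List (List Bool) := (bitStrings (k y)).filter (p y ·)
  have hg : Primrec g :=
    (PrimrecRel.listFilter (R := fun x y => p y x) (hp.comp Primrec.snd Primrec.fst)).comp
      (primrec_bitStrings.comp hk) Primrec.id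
  obtain ⟨c, hc⟩ := exists_condComplexity_le_of_mem hg
  refine ⟨c, fun y r hr x hx hpx => hc y r (le_of_eq_of_le ?_ hr) x ?_⟩
  · rw [← List.toFinset_card_of_nodup ((nodup_bitStrings _).filter _), ← Set.ncard_coe_finset]
    congr 1
    ext x
    simp [mem_bitStrings]
  · simp [g, mem_bitStrings, hx, hpx]

end Complexity

section GraphCode

variable {n : ℕ}

/-- The possible edges `(u, v)`, `u < v`, of a graph on `0, …, n - 1`, in lexicographic order. -/
def pairs (n : ℕ) : List (ℕ × ℕ) :=
  (List.range n).flatMap fun u => ((List.range n).filter fun v => u < v).map fun v => (u, v)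

theorem mem_pairs {a b : ℕ} : (a, b) ∈ pairs n ↔ a < b ∧ b < n := by
  simp only [pairs, List.mem_flatMap, List.mem_range, List.mem_map, List.mem_filter,
    decide_eq_true_eq, Prod.mk.injEq]
  constructor
  · rintro ⟨u, -, v, ⟨hv, huv⟩, rfl, rfl⟩
    exact ⟨huv, hv⟩
  · rintro ⟨hab, hb⟩
    exact ⟨a, hab.trans hb, b, ⟨hb, hab⟩, rfl, rfl⟩

theorem nodup_pairs (n : ℕ) : (pairs n).Nodup := by
  refine List.nodup_flatMap.2 ⟨fun u _ => (List.nodup_range.filter _).map fun v w h => by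
    simpa using h, List.nodup_range.imp fun {u v} huv => ?_⟩
  simp only [Function.onFun, List.disjoint_left]
  grind

theorem length_pairs (n : ℕ) : (pairs n).length = n * (n - 1) / 2 := by
  have hrow : ∀ u ∈ List.range n,
      (((List.range n).filter fun v => u < v).map fun v => (u, v)).length = n - 1 - u := by
    intro u _
    have hfilter : ((List.range n).filter fun v => u < v).toFinset = Finset.Ioo u n := by
      ext v; simp [and_comm]
    rw [List.length_map, ← List.toFinset_card_of_nodup (List.nodup_range.filter _), hfilter,
      Nat.card_Ioo, Nat.sub_right_comm]
  rw [pairs, List.length_flatMap, List.map_congr_left hrow, ← Finset.sum_range_id,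
    ← Finset.sum_range_reflect]
  rfl

theorem primrec_pairs : Primrec pairs := by
  have hfilter : Primrec₂ fun n u => (List.range n).filter fun v => u < v :=
    (PrimrecRel.listFilter (R := fun v u => u < v)
      (Primrec.nat_lt.comp Primrec.snd Primrec.fst)).comp
        (Primrec.list_range.comp Primrec.fst) Primrec.snd
  exact Primrec.list_flatMap Primrec.list_range (Primrec.list_map hfilter
    (Primrec.pair (Primrec.snd.comp Primrec.fst) Primrec.snd).to₂).to₂

/-- Adjacency of `u` and `v` in the graph on `0, …, n - 1` whose edge set has the characteristic
string `x` (read as continued by zeros if it is too short). -/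
def CodeAdj (n : ℕ) (x : List Bool) (u v : ℕ) : Prop :=
  u ≠ v ∧ x.getD ((pairs n).idxOf (min u v, max u v)) false = true

/-- The labeled graph on `n` nodes whose edge set has the characteristic string `x`. -/
def graphOfCode (n : ℕ) (x : List Bool) : SimpleGraph (Fin n) where
  Adj u v := CodeAdj n x u v
  symm := ⟨fun u v h => ⟨h.1.symm, by rw [min_comm, max_comm]; exact h.2⟩⟩
  loopless := ⟨fun _ h => h.1 rfl⟩

theorem graphOfCode_injOn (n : ℕ) :
    Set.InjOn (graphOfCode n) {x | x.length = (pairs n).length} := by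
  intro x hx y hy hxy
  refine List.ext_getElem (hx.trans hy.symm) fun i hix hiy => ?_
  have hi : i < (pairs n).length := hx ▸ hix
  obtain ⟨a, b, hab⟩ : ∃ a b, (pairs n)[i] = (a, b) := ⟨_, _, rfl⟩
  obtain ⟨hlt, hb⟩ : a < b ∧ b < n := mem_pairs.1 (hab ▸ List.getElem_mem hi)
  have hidx : (pairs n).idxOf (min a b, max a b) = i := by
    rw [min_eq_left hlt.le, max_eq_right hlt.le, ← hab, (nodup_pairs n).idxOf_getElem]
  have hadj := congrArg (fun G => G.Adj ⟨a, hlt.trans hb⟩ ⟨b, hb⟩) hxy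
  simpa [graphOfCode, CodeAdj, hlt.ne, hidx, hix, hiy] using hadj

open Classical in
theorem graphCode_eq_map_pairs (G : SimpleGraph (Fin n)) :
    graphCode G = (pairs n).map fun e =>
      decide (∃ (h₁ : e.1 < n) (h₂ : e.2 < n), G.Adj ⟨e.1, h₁⟩ ⟨e.2, h₂⟩) := by
  have hrange : List.range n = (List.finRange n).map Fin.val := by simp
  rw [graphCode, pairs, List.map_flatMap, hrange, List.flatMap_map]
  refine List.flatMap_congr fun u _ => ?_
  rw [List.filter_map, List.map_map, List.map_map]
  simp [Function.comp_def]

theorem length_graphCode (G : SimpleGraph (Fin n)) : (graphCode G).length = (pairs n).length := by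
  rw [graphCode_eq_map_pairs, List.length_map]

theorem graphOfCode_graphCode (G : SimpleGraph (Fin n)) : graphOfCode n (graphCode G) = G := by
  have hlt {u v : Fin n} (h : u < v) :
      CodeAdj n (graphCode G) u v ↔ G.Adj u v := by
    have hidx : (pairs n).idxOf ((u : ℕ), (v : ℕ)) < (pairs n).length :=
      List.idxOf_lt_length_of_mem (mem_pairs.2 ⟨h, v.2⟩)
    have hget : (pairs n)[(pairs n).idxOf ((u : ℕ), (v : ℕ))] = ((u : ℕ), (v : ℕ)) :=
      List.getElem_idxOf hidx
    rw [CodeAdj, min_eq_left (Fin.val_fin_le.2 h.le), max_eq_right (Fin.val_fin_le.2 h.le),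
      graphCode_eq_map_pairs, List.getD_eq_getElem _ _ (by simpa using hidx)]
    simp [hget, Fin.val_ne_of_ne h.ne]
  ext u v
  rcases lt_trichotomy u v with h | rfl | h
  · exact hlt h
  · simp
  · rw [SimpleGraph.adj_comm, G.adj_comm]
    exact hlt h

end GraphCode

section Independence

variable {Ω ι κ : Type*} {mΩ : MeasurableSpace Ω} {μ : Measure Ω}

theorem measure_biInter_eq_prod_of_iIndep {m : ι → MeasurableSpace Ω} (hm : iIndep m μ)
    (hle : ∀ i, m i ≤ mΩ) {T : κ → Set ι} {A : κ → Set Ω} {S : Finset κ}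
    (hT : (S : Set κ).PairwiseDisjoint T)
    (hA : ∀ k ∈ S, MeasurableSet[⨆ i ∈ T k, m i] (A k)) :
    μ (⋂ k ∈ S, A k) = ∏ k ∈ S, μ (A k) := by
  classical
  have := hm.isProbabilityMeasure
  induction S using Finset.induction_on with
  | empty => simp
  | insert k S hk ih =>
    have hdisj : Disjoint (T k) (⋃ j ∈ S, T j) := Set.disjoint_iUnion₂_right.2 fun j hj =>
      hT (by simp) (by simp [hj]) (ne_of_mem_of_not_mem hj hk).symm
    have hrest : MeasurableSet[⨆ i ∈ ⋃ j ∈ S, T j, m i] (⋂ j ∈ S, A j) :=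
      Finset.measurableSet_biInter _ fun j hj =>
        biSup_mono (f := m) (fun i hi => Set.mem_biUnion (Finset.mem_coe.2 hj) hi) _
          (hA j (Finset.mem_insert_of_mem hj))
    rw [Finset.set_biInter_insert, Finset.prod_insert hk,
      (Indep_iff ..).1 (indep_iSup_of_disjoint hle hm hdisj) _ _
        (hA k (Finset.mem_insert_self k S)) hrest,
      ih (hT.subset (by simp)) fun j hj => hA j (Finset.mem_insert_of_mem hj)]

end Independence

section BinomialRandom

variable {V : Type*} {p : I}

theorem map_mem_edgeSet_binomialRandom [Countable V] :
    G(V, p).map (fun G e => e ∈ G.edgeSet) = Measure.infinitePi fun e : Sym2 V =>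
      toNNReal p • Measure.dirac (¬ e.IsDiag) + toNNReal (σ p) • Measure.dirac False := by
  have hedge : G(V, p).map SimpleGraph.edgeSet = setBernoulli Sym2.diagSetᶜ p := by
    rw [SimpleGraph.binomialRandom, SimpleGraph.measurableEmbedding_edgeSet.map_comap]
    refine Measure.restrict_eq_self_of_ae_mem ?_
    filter_upwards [setBernoulli_ae_subset] with S hS
    exact ⟨SimpleGraph.fromEdgeSet S, by
      simpa [← Set.compl_ofPred, Set.subset_compl_iff_disjoint_right] using hS⟩
  have hcomp : (fun (G : SimpleGraph V) e => e ∈ G.edgeSet) =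
      (fun s e => e ∈ s) ∘ SimpleGraph.edgeSet := rfl
  rw [hcomp, ← Measure.map_map (by fun_prop) (by fun_prop), hedge, setBernoulli_eq_map,
    Measure.map_map (by fun_prop) (by fun_prop)]
  exact Measure.map_id

theorem measurable_mem_edgeSet (e : Sym2 V) :
    Measurable fun G : SimpleGraph V => e ∈ G.edgeSet :=
  (measurable_set_mem e).comp SimpleGraph.measurable_edgeSet

theorem map_mem_edgeSet_binomialRandom_apply [Countable V] (e : Sym2 V) :
    G(V, p).map (fun G => e ∈ G.edgeSet) =
      toNNReal p • Measure.dirac (¬ e.IsDiag) + toNNReal (σ p) • Measure.dirac False := by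
  have heval := congrArg (Measure.map fun x => x e)
    (map_mem_edgeSet_binomialRandom (V := V) (p := p))
  rwa [Measure.infinitePi_map_eval, Measure.map_map (by fun_prop)
    (measurable_pi_lambda _ measurable_mem_edgeSet)] at heval

theorem iIndepFun_mem_edgeSet [Countable V] :
    iIndepFun (fun (e : Sym2 V) (G : SimpleGraph V) => e ∈ G.edgeSet) G(V, p) := by
  rw [iIndepFun_iff_map_fun_eq_infinitePi_map measurable_mem_edgeSet]
  simp only [map_mem_edgeSet_binomialRandom, map_mem_edgeSet_binomialRandom_apply]

theorem binomialRandom_real_adj [Countable V] {u v : V} (h : u ≠ v) :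
    G(V, p).real {G | G.Adj u v} = p := by
  have hmap := Measure.map_apply (μ := G(V, p)) (measurable_mem_edgeSet s(u, v))
    (MeasurableSet.singleton True)
  rw [map_mem_edgeSet_binomialRandom_apply] at hmap
  have hpre : (fun G : SimpleGraph V => s(u, v) ∈ G.edgeSet) ⁻¹' {True} = {G | G.Adj u v} := by
    ext G; simp
  rw [measureReal_def, ← hpre, ← hmap]
  simp [h]

theorem measurableSet_adj (u v : V) : MeasurableSet {G : SimpleGraph V | G.Adj u v} := by
  measurability

theorem binomialRandom_real_adj_inter [Countable V] {u v w : V} (hu : w ≠ u) (hv : w ≠ v)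
    (huv : u ≠ v) : G(V, p).real {G | G.Adj u w ∧ G.Adj v w} = (p : ℝ) ^ 2 := by
  have hne : s(u, w) ≠ s(v, w) := by simp [huv, hu.symm]
  have h := (iIndepFun_mem_edgeSet (p := p) (V := V)).indepFun hne
    |>.measure_inter_preimage_eq_mul {True} {True} (by simp) (by simp)
  have hpre (x : V) : (fun G : SimpleGraph V => s(x, w) ∈ G.edgeSet) ⁻¹' {True} =
      {G | G.Adj x w} := by ext G; simp
  rw [hpre, hpre] at h
  rw [Set.ofPred_and, measureReal_def, h, ENNReal.toReal_mul, ← measureReal_def, ← measureReal_def,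
    binomialRandom_real_adj hu.symm, binomialRandom_real_adj hv.symm, sq]

theorem measurableSet_adj_comap (u v : V) :
    MeasurableSet[.comap (fun G : SimpleGraph V => s(u, v) ∈ G.edgeSet) inferInstance]
      {G : SimpleGraph V | G.Adj u v} :=
  ⟨{True}, MeasurableSet.singleton _, by ext G; simp⟩

theorem binomialRandom_real_no_common_neighbor [Countable V] {u v : V} (huv : u ≠ v)
    {S : Finset V} (hu : u ∉ S) (hv : v ∉ S) :
    G(V, p).real {G | ∀ w ∈ S, ¬(G.Adj u w ∧ G.Adj v w)} = (1 - (p : ℝ) ^ 2) ^ S.card := by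
  let m (e : Sym2 V) : MeasurableSpace (SimpleGraph V) :=
    MeasurableSpace.comap (fun G => e ∈ G.edgeSet) inferInstance
  have hadj (x w : V) (hx : x ∈ ({u, v} : Set V)) :
      MeasurableSet[⨆ e ∈ ({s(u, w), s(v, w)} : Set (Sym2 V)), m e] {G | G.Adj x w} :=
    le_iSup₂ (f := fun e (_ : e ∈ ({s(u, w), s(v, w)} : Set (Sym2 V))) => m e) s(x, w)
      (by rcases hx with rfl | rfl <;> simp) _ (measurableSet_adj_comap x w)
  have hdisj : (S : Set V).PairwiseDisjoint fun w => ({s(u, w), s(v, w)} : Set (Sym2 V)) := by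
    intro w hw w' hw' hne
    simp only [Function.onFun, Set.disjoint_left, Set.mem_insert_iff, Set.mem_singleton_iff]
    grind
  have hprod := measure_biInter_eq_prod_of_iIndep (μ := G(V, p)) (m := m)
    iIndepFun_mem_edgeSet.iIndep (fun e => (measurable_mem_edgeSet e).comap_le) hdisj
    (A := fun w => {G | G.Adj u w ∧ G.Adj v w}ᶜ)
    fun w _ => ((hadj u w (by simp)).inter (hadj v w (by simp))).compl
  have hset : {G : SimpleGraph V | ∀ w ∈ S, ¬(G.Adj u w ∧ G.Adj v w)} =
      ⋂ w ∈ S, {G | G.Adj u w ∧ G.Adj v w}ᶜ := by ext; simp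
  rw [hset, measureReal_def, hprod, ENNReal.toReal_prod, ← Finset.prod_const]
  refine Finset.prod_congr rfl fun w hw => ?_
  have hmeas : MeasurableSet {G : SimpleGraph V | G.Adj u w ∧ G.Adj v w} :=
    (measurableSet_adj u w).inter (measurableSet_adj v w)
  rw [← measureReal_def, probReal_compl_eq_one_sub hmeas,
    binomialRandom_real_adj_inter (by grind) (by grind) huv]

open Classical in
theorem degree_eq_sum_indicator [Fintype V] (G : SimpleGraph V) (u : V) :
    (G.degree u : ℝ) =
      ∑ w ∈ Finset.univ.erase u, {G : SimpleGraph V | G.Adj u w}.indicator 1 G := by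
  have herase : Finset.univ.filter (G.Adj u) = (Finset.univ.erase u).filter (G.Adj u) := by
    ext w; simpa using fun h : G.Adj u w => h.ne'
  simp [Set.indicator_apply, ← SimpleGraph.card_neighborFinset_eq_degree,
    SimpleGraph.neighborFinset_eq_filter, herase]

theorem iIndepFun_indicator_adj [Countable V] (u : V) :
    iIndepFun (fun (w : V) => {G : SimpleGraph V | G.Adj u w}.indicator (1 : SimpleGraph V → ℝ))
      G(V, p) := by
  classical
  have hinj : Function.Injective fun w => s(u, w) := fun v w h => Sym2.congr_right.1 h
  have hcomp := (iIndepFun_mem_edgeSet (p := p)).precomp hinj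
    |>.comp (fun _ P => if P then (1 : ℝ) else 0) fun _ => Measurable.of_discrete
  convert hcomp using 2 with w
  ext G
  simp [Set.indicator_apply]

open Classical in
theorem binomialRandom_real_degree_ge [Fintype V] (u : V) {t : ℝ} (ht : 0 ≤ t) :
    G(V, p).real {G | (p : ℝ) * (Fintype.card V - 1) + t ≤ G.degree u} ≤
      Real.exp (-2 * t ^ 2 / (Fintype.card V - 1)) := by
  let X (w : V) : SimpleGraph V → ℝ := {G : SimpleGraph V | G.Adj u w}.indicator 1
  have hmean (w : V) (hw : w ∈ Finset.univ.erase u) : ∫ G, X w G ∂G(V, p) = p := by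
    rw [integral_indicator_one (measurableSet_adj u w),
      binomialRandom_real_adj (Finset.ne_of_mem_erase hw).symm]
  have hsub (w : V) (hw : w ∈ Finset.univ.erase u) :
      HasSubgaussianMGF (fun G => X w G - p) (1 / 4) G(V, p) := by
    have hIcc : ∀ᵐ G ∂G(V, p), X w G ∈ Set.Icc (0 : ℝ) 1 := ae_of_all _ fun G =>
      ⟨Set.indicator_nonneg (fun _ _ => zero_le_one) _,
        Set.indicator_le_self' (fun _ _ => zero_le_one) _⟩
    have h := hasSubgaussianMGF_of_mem_Icc
      ((measurable_one.indicator (measurableSet_adj u w)).aemeasurable) hIcc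
    rw [hmean w hw] at h
    convert h using 1
    norm_num
  have hindep : iIndepFun (fun w G => X w G - p) G(V, p) :=
    (iIndepFun_indicator_adj u).comp (fun _ x => x - (p : ℝ)) fun _ => by fun_prop
  have htail := HasSubgaussianMGF.measure_sum_ge_le_of_iIndepFun hindep hsub ht
  have hcard : ((Finset.univ.erase u).card : ℝ) = Fintype.card V - 1 := by
    rw [Finset.card_erase_of_mem (Finset.mem_univ u), Finset.card_univ,
      Nat.cast_pred (Fintype.card_pos_iff.2 ⟨u⟩)]
  convert htail using 2
  · ext G
    rw [Set.mem_ofPred_eq, Set.mem_ofPred_eq, Finset.sum_sub_distrib, degree_eq_sum_indicator,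
      Finset.sum_const, nsmul_eq_mul, hcard, le_sub_iff_add_le, add_comm, mul_comm]
  · rw [Finset.sum_const, nsmul_eq_mul]
    push_cast
    rw [hcard, neg_mul, neg_div, neg_div, mul_comm (2 : ℝ), mul_div_assoc]
    congr 2
    field

end BinomialRandom

section Typical

/-- The uniform distribution on the labeled graphs on `n` nodes: every edge is present with
probability `1 / 2`, independently of the others. -/
noncomputable def uniformGraph (n : ℕ) : Measure (SimpleGraph (Fin n)) :=
  G(Fin n, ⟨1 / 2, by norm_num, by norm_num⟩)

instance (n : ℕ) : IsProbabilityMeasure (uniformGraph n) :=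
  inferInstanceAs (IsProbabilityMeasure G(Fin n, _))

open Classical in
/-- The typical graphs, for which compact routing tables exist: all degrees are at most
`n / 2 * (1 + 1 / L)` (stated without division), and any two nodes have a common neighbour among the
first `M` nodes. -/
def IsTypical (L M : ℕ) {n : ℕ} (G : SimpleGraph (Fin n)) : Prop :=
  (∀ u, 2 * L * G.degree u ≤ n * (L + 1)) ∧
    ∀ u v, u ≠ v → ∃ w ∈ G.commonNeighbors u v, (w : ℕ) < M

open Classical in
theorem uniformGraph_real_degree_gt {n L : ℕ} (hn : 2 ≤ n) (hL : 0 < L) (u : Fin n) :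
    (uniformGraph n).real {G | n * (L + 1) < 2 * L * G.degree u} ≤
      Real.exp (-(n / (2 * L ^ 2))) := by
  have hn' : (2 : ℝ) ≤ n := by exact_mod_cast hn
  have hsub : {G : SimpleGraph (Fin n) | n * (L + 1) < 2 * L * G.degree u} ⊆
      {G | 1 / 2 * ((Fintype.card (Fin n) : ℝ) - 1) + n / (2 * L) ≤ G.degree u} := fun G hG => by
    have hG' : (n : ℝ) * (L + 1) < 2 * L * G.degree u := by exact_mod_cast hG
    have hhalf : (n : ℝ) * (L + 1) / (2 * L) = 1 / 2 * n + n / (2 * L) := by field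
    have := (div_lt_iff₀' (by positivity)).2 hG'
    simp only [Set.mem_ofPred_eq, Fintype.card_fin]
    linarith
  refine (measureReal_mono hsub).trans ((binomialRandom_real_degree_ge u (by positivity)).trans ?_)
  rw [Fintype.card_fin, Real.exp_le_exp, neg_mul, neg_div, neg_le_neg_iff,
    le_div_iff₀ (by linarith)]
  have hsq : 2 * ((n : ℝ) / (2 * L)) ^ 2 = n / (2 * L ^ 2) * n := by field
  rw [hsq]
  gcongr
  linarith

theorem uniformGraph_real_no_common_neighbor_lt {n M : ℕ} (hM : M ≤ n) {u v : Fin n} (huv : u ≠ v) :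
    (uniformGraph n).real {G | ∀ w ∈ G.commonNeighbors u v, M ≤ (w : ℕ)} ≤ (3 / 4) ^ (M - 2) := by
  let B : Finset (Fin n) := Finset.univ.filter fun w => (w : ℕ) < M
  let S : Finset (Fin n) := (B.erase u).erase v
  have hS : M - 2 ≤ S.card :=
    calc M - 2 = B.card - 1 - 1 := by rw [Fin.card_filter_val_lt, min_eq_right hM, Nat.sub_sub]
      _ ≤ (B.erase u).card - 1 := Nat.sub_le_sub_right Finset.pred_card_le_card_erase 1
      _ ≤ S.card := Finset.pred_card_le_card_erase
  have hsub : {G : SimpleGraph (Fin n) | ∀ w ∈ G.commonNeighbors u v, M ≤ (w : ℕ)} ⊆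
      {G | ∀ w ∈ S, ¬(G.Adj u w ∧ G.Adj v w)} := fun G hG w hw hadj => by
    have := hG w hadj
    grind
  calc _ ≤ (uniformGraph n).real {G | ∀ w ∈ S, ¬(G.Adj u w ∧ G.Adj v w)} := measureReal_mono hsub
    _ = (1 - (1 / 2 : ℝ) ^ 2) ^ S.card :=
      binomialRandom_real_no_common_neighbor huv (by simp [S]) (by simp [S])
    _ = (3 / 4) ^ S.card := by norm_num
    _ ≤ (3 / 4) ^ (M - 2) := pow_le_pow_of_le_one (by norm_num) (by norm_num) hS

theorem uniformGraph_real_not_isTypical_le {n L M : ℕ} (hn : 2 ≤ n) (hL : 0 < L) (hM : M ≤ n) :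
    (uniformGraph n).real {G | ¬IsTypical L M G} ≤
      n * Real.exp (-(n / (2 * L ^ 2))) + n ^ 2 * (3 / 4) ^ (M - 2) := by
  classical
  have hsub : {G : SimpleGraph (Fin n) | ¬IsTypical L M G} ⊆
      (⋃ u ∈ Finset.univ, {G | n * (L + 1) < 2 * L * G.degree u}) ∪
        ⋃ e ∈ (Finset.univ : Finset (Fin n)).offDiag,
          {G | ∀ w ∈ G.commonNeighbors e.1 e.2, M ≤ (w : ℕ)} := fun G hG => by
    by_contra hG'
    simp only [Set.mem_union, Set.mem_iUnion, Finset.mem_univ, Finset.mem_offDiag,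
      Set.mem_ofPred_eq, not_or, not_exists, not_lt, exists_prop, true_and] at hG'
    refine hG ⟨hG'.1, fun u v huv => ?_⟩
    simpa [huv] using hG'.2 (u, v)
  refine (measureReal_mono hsub).trans ((measureReal_union_le _ _).trans (add_le_add ?_ ?_))
  · refine (measureReal_biUnion_finset_le _ _).trans ((Finset.sum_le_card_nsmul _ _ _ fun u _ =>
      uniformGraph_real_degree_gt hn hL u).trans_eq ?_)
    simp
  · refine (measureReal_biUnion_finset_le _ _).trans ((Finset.sum_le_card_nsmul _ _ _ fun e he =>
      uniformGraph_real_no_common_neighbor_lt hM (Finset.mem_offDiag.1 he).2.2).trans ?_)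
    rw [nsmul_eq_mul, Finset.offDiag_card, Finset.card_univ, Fintype.card_fin, sq, ← Nat.cast_mul]
    gcongr
    exact Nat.sub_le _ _

theorem two_pow_mul_three_quarters_pow_le {a b k : ℕ} (h : 3 * (a + b) ≤ k) :
    (2 : ℝ) ^ a * (3 / 4) ^ k ≤ (1 / 2) ^ b :=
  calc (2 : ℝ) ^ a * (3 / 4) ^ k ≤ 2 ^ a * (3 / 4) ^ (3 * (a + b)) := by
        gcongr _ * ?_; exact pow_le_pow_of_le_one (by norm_num) (by norm_num) h
    _ ≤ 2 ^ a * (1 / 2) ^ (a + b) := by rw [pow_mul]; gcongr; norm_num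
    _ = (1 / 2) ^ b := by rw [pow_add, ← mul_assoc, ← mul_pow]; norm_num

theorem exp_neg_natCast_le_three_quarters_pow (k : ℕ) : Real.exp (-k) ≤ (3 / 4) ^ k := by
  rw [← mul_neg_one, Real.exp_nat_mul]
  gcongr
  exact Real.exp_neg_one_lt_half.le.trans (by norm_num)

theorem uniformGraph_real_not_isTypical_le_half_pow {n c d : ℕ} (hc : 3 * c + 8 ≤ Nat.log 2 n)
    (hn : 2 * Nat.log 2 n ^ 3 * (Nat.log 2 n + d) ≤ n) :
    (uniformGraph n).real {G | ¬IsTypical (Nat.log 2 n) (Nat.log 2 n * (Nat.log 2 n + d)) G} ≤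
      (1 / 2) ^ (d + c) := by
  have hlog : n < 2 ^ (Nat.log 2 n + 1) := Nat.lt_pow_succ_log_self one_lt_two n
  set L := Nat.log 2 n
  set M := L * (L + d)
  have hL : 0 < L := by omega
  have hn2 : 2 ≤ n := (Nat.log_pos_iff.1 hL).1
  have hLM : 2 * L ^ 2 * M ≤ n := by rwa [show 2 * L ^ 2 * M = 2 * L ^ 3 * (L + d) by ring]
  have hMn : M ≤ n := (Nat.le_mul_of_pos_left M (by positivity)).trans hLM
  have hM : 3 * ((2 * L + 3) + (d + c)) ≤ M - 2 := by
    have hL2 : (3 * c + 8) * L ≤ L * L := Nat.mul_le_mul_right L hc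
    have hLd : 8 * d ≤ L * d := Nat.mul_le_mul_right d (by omega)
    have hcL : 3 * c * 1 ≤ 3 * c * L := Nat.mul_le_mul_left _ hL
    have hMexp : M = L * L + L * d := mul_add L L d
    rw [add_mul] at hL2
    omega
  have hexp : Real.exp (-(n / (2 * L ^ 2))) ≤ (3 / 4) ^ (M - 2) :=
    calc Real.exp (-(n / (2 * L ^ 2))) ≤ Real.exp (-M) := by
          rw [Real.exp_le_exp, neg_le_neg_iff, le_div_iff₀' (by positivity)]
          exact_mod_cast hLM
      _ ≤ (3 / 4) ^ M := exp_neg_natCast_le_three_quarters_pow M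
      _ ≤ (3 / 4) ^ (M - 2) := pow_le_pow_of_le_one (by norm_num) (by norm_num) (Nat.sub_le M 2)
  calc _ ≤ (n : ℝ) * Real.exp (-(n / (2 * L ^ 2))) + n ^ 2 * (3 / 4) ^ (M - 2) :=
        uniformGraph_real_not_isTypical_le hn2 hL hMn
    _ ≤ n ^ 2 * (3 / 4) ^ (M - 2) + n ^ 2 * (3 / 4) ^ (M - 2) := by
        gcongr
        exact_mod_cast Nat.le_self_pow two_ne_zero n
    _ = 2 * n ^ 2 * (3 / 4) ^ (M - 2) := by ring
    _ ≤ 2 * (2 ^ (L + 1)) ^ 2 * (3 / 4) ^ (M - 2) := by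
        gcongr
        exact_mod_cast hlog.le
    _ = 2 ^ (2 * L + 3) * (3 / 4) ^ (M - 2) := by ring
    _ ≤ (1 / 2) ^ (d + c) := two_pow_mul_three_quarters_pow_le hM

end Typical

section Decidability

variable {α : Type*} [Primcodable α] {n : α → ℕ} {x : α → List Bool} {R : α → ℕ → Prop}

theorem primrecPred_forall_fin (hn : Primrec n) (hR : PrimrecRel R) :
    PrimrecPred fun a => ∀ i : Fin (n a), R a i :=
  ((PrimrecRel.forall_mem_list hR.swap).comp (Primrec.list_range.comp hn) Primrec.id).of_eq
    fun _ => by simp [Function.swap, Fin.forall_iff]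

theorem primrecPred_exists_fin (hn : Primrec n) (hR : PrimrecRel R) :
    PrimrecPred fun a => ∃ i : Fin (n a), R a i :=
  ((PrimrecRel.exists_mem_list hR.swap).comp (Primrec.list_range.comp hn) Primrec.id).of_eq
    fun _ => by simp [Function.swap, Fin.exists_iff]

open Classical in
theorem primrec_card_filter_fin (hn : Primrec n) (hR : PrimrecRel R) :
    Primrec fun a => (Finset.univ.filter fun i : Fin (n a) => R a i).card := by
  have hfilter : Primrec fun a => ((List.range (n a)).filter (R a ·)).length :=
    Primrec.list_length.comp ((PrimrecRel.listFilter (R := fun i a => R a i)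
      (hR.comp Primrec.snd Primrec.fst)).comp (Primrec.list_range.comp hn) Primrec.id)
  refine hfilter.of_eq fun a => ?_
  rw [← List.toFinset_card_of_nodup (List.nodup_range.filter _),
    ← Finset.card_map Fin.valEmbedding]
  congr 1
  ext i
  simp [Fin.exists_iff, and_comm]

theorem primrec_log : Primrec (Nat.log 2) := by
  have hgreatest : Primrec fun n : ℕ => n.findGreatest fun k => 2 ^ k ≤ n :=
    Primrec.nat_findGreatest (p := fun n k => 2 ^ k ≤ n) Primrec.id
      (Primrec.nat_le.comp (primrec_pow.comp (Primrec.const 2) Primrec.snd) Primrec.fst)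
  refine hgreatest.of_eq fun n => ?_
  rcases Nat.eq_zero_or_pos n with rfl | hn
  · simp
  · refine Nat.findGreatest_eq_iff.2 ⟨Nat.log_le_self 2 n,
      fun _ => Nat.pow_log_le_self 2 hn.ne', fun k hk _ => ?_⟩
    exact (Nat.lt_pow_of_log_lt one_lt_two hk).not_ge

theorem primrecPred_codeAdj {u v : α → ℕ} (hn : Primrec n) (hx : Primrec x)
    (hu : Primrec u) (hv : Primrec v) : PrimrecPred fun a => CodeAdj (n a) (x a) (u a) (v a) := by
  have hpos : Primrec fun a => (pairs (n a)).idxOf (min (u a) (v a), max (u a) (v a)) :=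
    (Primrec.list_idxOf.comp
      (Primrec.pair (Primrec.nat_min.comp hu hv) (Primrec.nat_max.comp hu hv))
      (primrec_pairs.comp hn)).of_eq fun _ => by congr!
  exact (Primrec.eq.comp hu hv).not.and
    (Primrec.eq.comp ((Primrec.list_getD false).comp hx hpos) (Primrec.const true))

open Classical in
theorem primrecPred_degree_le_graphOfCode {k b : α → ℕ} (hn : Primrec n) (hx : Primrec x)
    (hk : Primrec k) (hb : Primrec b) :
    PrimrecPred fun a => ∀ u, k a * (graphOfCode (n a) (x a)).degree u ≤ b a := by
  have hcount : Primrec fun z : α × ℕ =>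
      (Finset.univ.filter fun w : Fin (n z.1) => CodeAdj (n z.1) (x z.1) z.2 w).card :=
    primrec_card_filter_fin (hn.comp Primrec.fst) (primrecPred_codeAdj
      (hn.comp (Primrec.fst.comp Primrec.fst)) (hx.comp (Primrec.fst.comp Primrec.fst))
      (Primrec.snd.comp Primrec.fst) Primrec.snd)
  have hbound : PrimrecRel fun (a : α) (u : ℕ) =>
      k a * (Finset.univ.filter fun w : Fin (n a) => CodeAdj (n a) (x a) u w).card ≤ b a :=
    Primrec.nat_le.comp (Primrec.nat_mul.comp (hk.comp Primrec.fst) hcount) (hb.comp Primrec.fst)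
  refine (primrecPred_forall_fin hn hbound).of_eq fun z => forall_congr' fun u => ?_
  rw [← SimpleGraph.card_neighborFinset_eq_degree, SimpleGraph.neighborFinset_eq_filter]
  rfl

theorem primrecPred_commonNeighbors_graphOfCode {M : α → ℕ} (hn : Primrec n) (hx : Primrec x)
    (hM : Primrec M) : PrimrecPred fun a => ∀ u v, u ≠ v →
      ∃ w ∈ (graphOfCode (n a) (x a)).commonNeighbors u v, (w : ℕ) < M a := by
  have ha : Primrec fun z : ((α × ℕ) × ℕ) × ℕ => z.1.1.1 :=
    Primrec.fst.comp (Primrec.fst.comp Primrec.fst)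
  have hw : PrimrecRel fun (z : (α × ℕ) × ℕ) (w : ℕ) =>
      (CodeAdj (n z.1.1) (x z.1.1) z.1.2 w ∧ CodeAdj (n z.1.1) (x z.1.1) z.2 w) ∧ w < M z.1.1 :=
    ((primrecPred_codeAdj (hn.comp ha) (hx.comp ha)
        (Primrec.snd.comp (Primrec.fst.comp Primrec.fst)) Primrec.snd).and
      (primrecPred_codeAdj (hn.comp ha) (hx.comp ha) (Primrec.snd.comp Primrec.fst)
        Primrec.snd)).and
      (Primrec.nat_lt.comp Primrec.snd (hM.comp ha))
  have hv : PrimrecRel fun (z : α × ℕ) (v : ℕ) => z.2 = v ∨ ∃ w : Fin (n z.1),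
      (CodeAdj (n z.1) (x z.1) z.2 w ∧ CodeAdj (n z.1) (x z.1) v w) ∧ (w : ℕ) < M z.1 :=
    (Primrec.eq.comp (Primrec.snd.comp Primrec.fst) Primrec.snd).or
      (primrecPred_exists_fin (hn.comp (Primrec.fst.comp Primrec.fst)) hw)
  have hu : PrimrecRel fun (a : α) (u : ℕ) => ∀ v : Fin (n a), u = v ∨ ∃ w : Fin (n a),
      (CodeAdj (n a) (x a) u w ∧ CodeAdj (n a) (x a) v w) ∧ (w : ℕ) < M a :=
    primrecPred_forall_fin (hn.comp Primrec.fst) hv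
  refine (primrecPred_forall_fin hn hu).of_eq fun z => forall₂_congr fun u v => ?_
  rw [Fin.val_inj, or_iff_not_imp_left]
  rfl

theorem primrecPred_isTypical_graphOfCode {L M : α → ℕ} (hn : Primrec n) (hx : Primrec x)
    (hL : Primrec L) (hM : Primrec M) :
    PrimrecPred fun a => IsTypical (L a) (M a) (graphOfCode (n a) (x a)) :=
  (primrecPred_degree_le_graphOfCode hn hx (Primrec.nat_mul.comp (Primrec.const 2) hL)
    (Primrec.nat_mul.comp hn (Primrec.succ.comp hL))).and
    (primrecPred_commonNeighbors_graphOfCode hn hx hM)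

end Decidability

section Incompressibility

theorem uniformGraph_real_eq_ncard_div {n : ℕ} (S : Set (SimpleGraph (Fin n))) :
    (uniformGraph n).real S = S.ncard / 2 ^ (n * (n - 1) / 2) := by
  classical
  have hsingle (G : SimpleGraph (Fin n)) :
      (uniformGraph n).real {G} = (2 ^ (n * (n - 1) / 2))⁻¹ := by
    have hle : G.edgeSet.ncard ≤ n * (n - 1) / 2 := by
      simpa [← G.coe_edgeFinset, -SimpleGraph.coe_edgeFinset, Nat.choose_two_right] using
        G.card_edgeFinset_le_card_choose_two
    have hsymm : (1 - 2⁻¹ : ℝ) = 2⁻¹ := by norm_num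
    rw [measureReal_def, uniformGraph, SimpleGraph.binomialRandom_singleton]
    simp [hsymm, ← mul_inv, ← pow_add, Nat.add_sub_of_le hle, Nat.choose_two_right]
  have : MeasurableSingletonClass (SimpleGraph (Fin n)) := ⟨fun G => by
    simpa [← Set.image_singleton, Set.preimage_image_eq _ SimpleGraph.edgeSet_injective] using
      SimpleGraph.measurable_edgeSet (measurableSet_singleton G.edgeSet)⟩
  rw [← Set.coe_toFinset S, ← sum_measureReal_singleton, Finset.sum_congr rfl fun G _ => hsingle G,
    Finset.sum_const, nsmul_eq_mul, Set.ncard_coe_finset, div_eq_mul_inv]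

theorem ncard_code_le {n : ℕ} (P : SimpleGraph (Fin n) → Prop) :
    {x | x.length = n * (n - 1) / 2 ∧ P (graphOfCode n x)}.ncard ≤ {G | P G}.ncard := by
  rw [← length_pairs]
  exact Set.ncard_le_ncard_of_injOn (graphOfCode n) (fun x hx => hx.2)
    ((graphOfCode_injOn n).mono fun x hx => hx.1)

theorem exists_not_of_isRandomGraph {P : ∀ n, ℕ → SimpleGraph (Fin n) → Prop}
    (hP : PrimrecPred fun z : (ℕ × ℕ) × List Bool => P z.1.1 z.1.2 (graphOfCode z.1.1 z.2)) :
    ∃ c, ∀ n d, (uniformGraph n).real {G | P n d G} ≤ (1 / 2) ^ (d + c) →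
      ∀ G, IsRandomGraph d G → ¬P n d G := by
  have hlength : Primrec fun y : ℕ => y.unpair.1 * (y.unpair.1 - 1) / 2 := by
    have hn : Primrec fun y : ℕ => y.unpair.1 := Primrec.fst.comp Primrec.unpair
    exact Primrec.nat_div.comp (Primrec.nat_mul.comp hn (Primrec.pred.comp hn)) (Primrec.const 2)
  have hcode : PrimrecRel fun (y : ℕ) (x : List Bool) =>
      P y.unpair.1 y.unpair.2 (graphOfCode y.unpair.1 x) :=
    hP.comp (Primrec.pair (Primrec.unpair.comp Primrec.fst) Primrec.snd)
  obtain ⟨c, hc⟩ := exists_condComplexity_le_of_ncard hlength hcode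
  refine ⟨c + 1, fun n d hprob G hG hPG => ?_⟩
  obtain ⟨y, rfl, rfl⟩ : ∃ y : ℕ, n = y.unpair.1 ∧ d = y.unpair.2 := ⟨Nat.pair n d, by simp⟩
  rw [IsRandomGraph, Nat.pair_unpair] at hG
  set N := y.unpair.1 * (y.unpair.1 - 1) / 2
  have hcard : ({G | P y.unpair.1 y.unpair.2 G}.ncard : ℝ) * 2 ^ (y.unpair.2 + (c + 1)) ≤
      2 ^ N := by
    rwa [uniformGraph_real_eq_ncard_div, one_div_pow, div_le_div_iff₀ (by positivity)
      (by positivity), one_mul] at hprob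
  norm_cast at hcard
  have hpos : 0 < {G | P y.unpair.1 y.unpair.2 G}.ncard := (Set.ncard_pos).2 ⟨G, hPG⟩
  have hle : y.unpair.2 + (c + 1) ≤ N := (Nat.pow_le_pow_iff_right one_lt_two).1
    ((Nat.le_mul_of_pos_left _ hpos).trans hcard)
  have hcount : {G | P y.unpair.1 y.unpair.2 G}.ncard ≤ 2 ^ (N - (y.unpair.2 + (c + 1))) := by
    rwa [← Nat.pow_div hle two_pos, Nat.le_div_iff_mul_le (by positivity)]
  have hshort : condComplexity (graphCode G) y ≤ N - (y.unpair.2 + (c + 1)) + c :=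
    hc y _ ((ncard_code_le _).trans hcount) _ (by rw [length_graphCode, length_pairs])
      (by rwa [graphOfCode_graphCode])
  omega

theorem exists_isTypical_of_isRandomGraph : ∃ c, ∀ n d, 3 * c + 8 ≤ Nat.log 2 n →
    2 * Nat.log 2 n ^ 3 * (Nat.log 2 n + d) ≤ n → ∀ G : SimpleGraph (Fin n), IsRandomGraph d G →
      IsTypical (Nat.log 2 n) (Nat.log 2 n * (Nat.log 2 n + d)) G := by
  have hn : Primrec fun z : (ℕ × ℕ) × List Bool => z.1.1 := Primrec.fst.comp Primrec.fst
  have hlog := primrec_log.comp hn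
  have htypical := primrecPred_isTypical_graphOfCode hn Primrec.snd hlog
    (Primrec.nat_mul.comp hlog (Primrec.nat_add.comp hlog (Primrec.snd.comp Primrec.fst)))
  obtain ⟨c, hc⟩ := exists_not_of_isRandomGraph
    (P := fun n d G => ¬IsTypical (Nat.log 2 n) (Nat.log 2 n * (Nat.log 2 n + d)) G) htypical.not
  exact ⟨c, fun n d hcn hdn G hG => not_not.1 <|
    hc n d (uniformGraph_real_not_isTypical_le_half_pow hcn hdn) G hG⟩

end Incompressibility

section RoutingTable

/-- An entry of a local routing table: the (zero-based) port for a destination, or the index of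
another entry of the table, from which the port has to be taken. -/
inductive TableEntry
  | port (p : ℕ)
  | via (w : ℕ)

/-- The encoding of a table entry: a flag followed by a port number of `l` bits or an index of
`m` bits. -/
def TableEntry.encode (l m : ℕ) : TableEntry → List Bool
  | port p => true :: toBits l p
  | via w => false :: toBits m w

/-- The number in a table entry fits into the field that `TableEntry.encode l m` reserves for it. -/
def TableEntry.Fits (l m : ℕ) : TableEntry → Prop
  | port p => p < 2 ^ l
  | via w => w < 2 ^ m

/-- The encoding of a routing table with fields of `l` and `m` bits. -/
def encodeTable (l m : ℕ) (T : List TableEntry) : List Bool := T.flatMap (TableEntry.encode l m)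

/-- The table `T` determines port `p` for destination `i`, with at most one reference. -/
def Resolves (T : List TableEntry) (i p : ℕ) : Prop :=
  T[i]? = some (.port p) ∨ ∃ w, T[i]? = some (.via w) ∧ T[w]? = some (.port p)

/-- Removes the first entry from the encoding of a table. -/
def skipEntry (l m : ℕ) (t : List Bool) : List Bool := t.drop (cond t.headI l m + 1)

/-- The number in the first entry of the encoding of a table, if its field has `k` bits. -/
def entryArg (k : ℕ) (t : List Bool) : ℕ := ofBits (t.tail.take k)

/-- Looks up the port for destination `i` in the encoding of a table. -/
def tableLookup (l m : ℕ) (t : List Bool) (i : ℕ) : ℕ :=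
  cond ((skipEntry l m)^[i] t).headI (entryArg l ((skipEntry l m)^[i] t))
    (entryArg l ((skipEntry l m)^[entryArg m ((skipEntry l m)^[i] t)] t))

/-- Splits a self-delimiting unary number off a string. -/
def splitUnary (q : List Bool) : ℕ × List Bool := ((q.takeWhile id).length, (q.dropWhile id).tail)

/-- The interpreter of routing tables: the two field widths precede the table in unary. The
destination and the result are labels, which start at `1`. -/
def runTable (q : List Bool) (y : ℕ) : ℕ :=
  tableLookup (splitUnary q).1 (splitUnary (splitUnary q).2).1 (splitUnary (splitUnary q).2).2
    (y - 1) + 1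

theorem primrec_entryArg : Primrec₂ entryArg :=
  primrec_ofBits.comp (Primrec.list_take.comp Primrec.fst (Primrec.list_tail.comp Primrec.snd))

theorem primrec_tableLookup {α : Type*} [Primcodable α] {l m i : α → ℕ} {t : α → List Bool}
    (hl : Primrec l) (hm : Primrec m) (ht : Primrec t) (hi : Primrec i) :
    Primrec fun a => tableLookup (l a) (m a) (t a) (i a) := by
  have hskip : Primrec₂ fun a => skipEntry (l a) (m a) :=
    Primrec.list_drop.comp (Primrec.succ.comp (Primrec.cond (Primrec.list_headI.comp Primrec.snd)
      (hl.comp Primrec.fst) (hm.comp Primrec.fst))) Primrec.snd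
  have hentry {j : α → ℕ} (hj : Primrec j) : Primrec fun a => (skipEntry (l a) (m a))^[j a] (t a) :=
    Primrec.nat_iterate hj ht hskip
  exact Primrec.cond (Primrec.list_headI.comp (hentry hi)) (primrec_entryArg.comp hl (hentry hi))
    (primrec_entryArg.comp hl (hentry (primrec_entryArg.comp hm (hentry hi))))

theorem primrec_splitUnary : Primrec splitUnary :=
  (Primrec.list_length.comp (Primrec.list_takeWhile Primrec.id)).pair
    (Primrec.list_tail.comp (Primrec.list_dropWhile Primrec.id))

theorem primrec_runTable : Primrec₂ runTable := by
  have hsplit := primrec_splitUnary.comp (Primrec.fst (α := List Bool) (β := ℕ))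
  have hsplit' := primrec_splitUnary.comp (Primrec.snd.comp hsplit)
  exact Primrec.succ.comp (primrec_tableLookup (Primrec.fst.comp hsplit) (Primrec.fst.comp hsplit')
    (Primrec.snd.comp hsplit') (Primrec.pred.comp Primrec.snd))

theorem splitUnary_replicate_append (l : ℕ) (q : List Bool) :
    splitUnary (List.replicate l true ++ false :: q) = (l, q) := by
  rw [splitUnary, List.takeWhile_append_of_pos (by simp), List.dropWhile_append_of_pos (by simp)]
  simp

variable {l m : ℕ}

theorem skipEntry_encode_append (e : TableEntry) (t : List Bool) :
    skipEntry l m (e.encode l m ++ t) = t := by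
  cases e <;> simp [skipEntry, TableEntry.encode]

theorem iterate_skipEntry_encodeTable (T : List TableEntry) (i : ℕ) :
    (skipEntry l m)^[i] (encodeTable l m T) = encodeTable l m (T.drop i) := by
  induction i generalizing T with
  | zero => rfl
  | succ i ih =>
    rw [Function.iterate_succ_apply]
    cases T with
    | nil => simpa [encodeTable, skipEntry] using ih []
    | cons e T => rw [encodeTable, List.flatMap_cons, skipEntry_encode_append]; exact ih T

theorem exists_iterate_skipEntry_encodeTable {T : List TableEntry} {i : ℕ} {e : TableEntry}
    (h : T[i]? = some e) :
    ∃ t, (skipEntry l m)^[i] (encodeTable l m T) = e.encode l m ++ t := by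
  obtain ⟨hi, rfl⟩ := List.getElem?_eq_some_iff.1 h
  exact ⟨encodeTable l m (T.drop (i + 1)), by
    rw [iterate_skipEntry_encodeTable, List.drop_eq_getElem_cons hi]; rfl⟩

theorem entryArg_append {k a : ℕ} (ha : a < 2 ^ k) (b : Bool) (t : List Bool) :
    entryArg k (b :: (toBits k a ++ t)) = a := by
  rw [entryArg, List.tail_cons, List.take_left' (length_toBits k a), ofBits_toBits ha]

theorem tableLookup_encodeTable {T : List TableEntry} (hT : ∀ e ∈ T, e.Fits l m) {i p : ℕ}
    (h : Resolves T i p) : tableLookup l m (encodeTable l m T) i = p := by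
  have hport {j : ℕ} (hj : T[j]? = some (.port p)) :
      ∃ t, (skipEntry l m)^[j] (encodeTable l m T) = true :: (toBits l p ++ t) :=
    exists_iterate_skipEntry_encodeTable hj
  rcases h with hi | ⟨w, hi, hw⟩
  · obtain ⟨t, ht⟩ := hport hi
    rw [tableLookup, ht, List.headI_cons, cond_true,
      entryArg_append (hT _ (List.mem_of_getElem? hi))]
  · obtain ⟨t, ht⟩ : ∃ t, (skipEntry l m)^[i] (encodeTable l m T) = false :: (toBits m w ++ t) :=
      exists_iterate_skipEntry_encodeTable hi
    obtain ⟨t', ht'⟩ := hport hw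
    rw [tableLookup, ht, List.headI_cons, cond_false,
      entryArg_append (hT _ (List.mem_of_getElem? hi)), ht',
      entryArg_append (hT _ (List.mem_of_getElem? hw))]

theorem exists_program_of_table : ∃ c : ℕ, ∀ (l m : ℕ) (T : List TableEntry),
    (∀ e ∈ T, e.Fits l m) → ∃ F : List Bool, F.length = c + l + m + (encodeTable l m T).length ∧
      ∀ i p, Resolves T i p → p + 1 ∈ universalMachine F (i + 1) := by
  obtain ⟨s, hs⟩ := universalMachine_universal (fun z => (runTable z.1 z.2 : ℕ))
    primrec_runTable.to_comp.partrec
  refine ⟨s.length + 2, fun l m T hT => ⟨s ++ (List.replicate l true ++ false ::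
    (List.replicate m true ++ false :: encodeTable l m T)), ?_, fun i p h => ?_⟩⟩
  · simp only [List.length_append, List.length_cons, List.length_replicate]
    omega
  · rw [hs, runTable, splitUnary_replicate_append, splitUnary_replicate_append,
      Nat.add_sub_cancel, tableLookup_encodeTable hT h]
    exact Part.mem_some _

end RoutingTable

section Routing

variable {n : ℕ} {G : SimpleGraph (Fin n)} {π : PortAssignment G}

theorem isShortestPathRouting_of_forwards {F : Fin n → List Bool}
    (hadj : ∀ u v, G.Adj u v → Forwards π F v u v)
    (hnadj : ∀ u v, u ≠ v → ¬G.Adj u v → ∃ w ∈ G.commonNeighbors u v, Forwards π F v u w) :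
    IsShortestPathRouting π F := by
  intro u v
  by_cases huv : u = v
  · subst huv
    exact ⟨SimpleGraph.Reachable.refl _, by rw [SimpleGraph.dist_self]; exact Route.arrived⟩
  by_cases h : G.Adj u v
  · refine ⟨h.reachable, ?_⟩
    rw [SimpleGraph.dist_eq_one_iff_adj.2 h]
    exact Route.step huv (hadj u v h) Route.arrived
  · obtain ⟨w, ⟨huw, hvw⟩, hforward⟩ := hnadj u v huv h
    have hreach : G.Reachable u v := huw.reachable.trans hvw.symm.reachable
    have hdist : G.dist u v = 2 := by
      have hle : G.dist u v ≤ 2 := SimpleGraph.dist_le (.cons huw (.cons hvw.symm .nil))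
      have hzero : G.dist u v ≠ 0 := fun h0 => huv (hreach.dist_eq_zero_iff.1 h0)
      have hone : G.dist u v ≠ 1 := fun h1 => h (SimpleGraph.dist_eq_one_iff_adj.1 h1)
      omega
    rw [hdist]
    exact ⟨hreach, Route.step huv hforward (Route.step hvw.ne' (hadj w v hvw.symm) Route.arrived)⟩

open Classical in
/-- The routing table of `u`: the ports of the neighbours of `u`, and for every other node `v`
a reference to the entry of the intermediate node `hub u v`. -/
noncomputable def localTable (π : PortAssignment G) (hub : Fin n → Fin n → ℕ) (u : Fin n) :
    List TableEntry :=
  List.ofFn fun v => if h : G.Adj u v then .port (π u ⟨v, h⟩) else .via (hub u v)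

variable {hub : Fin n → Fin n → ℕ} {l m : ℕ}

open Classical in
theorem length_encodeTable_localTable_le (u : Fin n) :
    (encodeTable l m (localTable π hub u)).length ≤ n + G.degree u * l + n * m := by
  have hentry (v : Fin n) :
      ((if h : G.Adj u v then .port (π u ⟨v, h⟩) else .via (hub u v) :
        TableEntry).encode l m).length ≤ 1 + (if G.Adj u v then l else 0) + m := by
    split_ifs <;> (simp only [TableEntry.encode, List.length_cons, length_toBits]; omega)
  calc (encodeTable l m (localTable π hub u)).length
      ≤ ∑ v, (1 + (if G.Adj u v then l else 0) + m) := by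
        rw [encodeTable, localTable, List.length_flatMap, List.map_ofFn, List.sum_ofFn]
        exact Finset.sum_le_sum fun v _ => hentry v
    _ = n + G.degree u * l + n * m := by
        rw [Finset.sum_add_distrib, Finset.sum_add_distrib, ← Finset.sum_filter,
          ← SimpleGraph.neighborFinset_eq_filter]
        simp

theorem fits_of_mem_localTable (hl : n ≤ 2 ^ l) {u : Fin n} (hhub : ∀ v, hub u v < 2 ^ m) :
    ∀ e ∈ localTable π hub u, e.Fits l m := by
  classical
  refine List.forall_mem_ofFn_iff.2 fun v => ?_
  split_ifs with h
  · have hcard : Nat.card (G.neighborSet u) ≤ Nat.card (Fin n) :=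
      Nat.card_le_card_of_injective _ Subtype.val_injective
    rw [Nat.card_fin] at hcard
    exact (π u ⟨v, h⟩).2.trans_le (hcard.trans hl)
  · exact hhub v

theorem getElem?_localTable_of_adj {u v : Fin n} (h : G.Adj u v) :
    (localTable π hub u)[(v : ℕ)]? = some (.port (π u ⟨v, h⟩)) := by
  simp [localTable, h]

theorem getElem?_localTable_of_not_adj {u v : Fin n} (h : ¬G.Adj u v) :
    (localTable π hub u)[(v : ℕ)]? = some (.via (hub u v)) := by
  simp [localTable, h]

open Classical in
theorem exists_isShortestPathRouting : ∃ c : ℕ, ∀ (n l m : ℕ) (G : SimpleGraph (Fin n))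
    (π : PortAssignment G), n ≤ 2 ^ l →
    (∀ u v, u ≠ v → ∃ w ∈ G.commonNeighbors u v, (w : ℕ) < 2 ^ m) →
    ∃ F : Fin n → List Bool, IsShortestPathRouting π F ∧
      ∀ u, (F u).length ≤ c + l + m + n + G.degree u * l + n * m := by
  obtain ⟨c, hc⟩ := exists_program_of_table
  refine ⟨c, fun n l m G π hl hcommon => ?_⟩
  have hhub (u v : Fin n) :
      ∃ w : ℕ, w < 2 ^ m ∧ (u ≠ v → ∃ w' : Fin n, w = w' ∧ w' ∈ G.commonNeighbors u v) := by
    by_cases huv : u = v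
    · exact ⟨0, by positivity, fun h => absurd huv h⟩
    · obtain ⟨w, hw, hwm⟩ := hcommon u v huv
      exact ⟨w, hwm, fun _ => ⟨w, rfl, hw⟩⟩
  choose hub hhub_lt hhub_common using hhub
  choose F hF_length hF using fun u =>
    hc l m (localTable π hub u) (fits_of_mem_localTable hl (hhub_lt u))
  refine ⟨F, isShortestPathRouting_of_forwards (fun u v h => ⟨h, ?_⟩) (fun u v huv h => ?_),
    fun u => ?_⟩
  · exact hF u v _ (Or.inl (getElem?_localTable_of_adj h))
  · obtain ⟨w, hw, huw, hvw⟩ := hhub_common u v huv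
    refine ⟨w, ⟨huw, hvw⟩, huw, hF u v _ (Or.inr ⟨w, ?_, getElem?_localTable_of_adj huw⟩)⟩
    rw [getElem?_localTable_of_not_adj h, hw]
  · have := length_encodeTable_localTable_le (π := π) (hub := hub) (l := l) (m := m) u
    rw [hF_length u]
    omega

end Routing

section RandomGraphRouting

theorem exists_isShortestPathRouting_of_isRandomGraph : ∃ c : ℕ, ∀ n d : ℕ, c ≤ Nat.log 2 n →
    2 * Nat.log 2 n ^ 3 * (Nat.log 2 n + d) ≤ n → ∀ G : SimpleGraph (Fin n), IsRandomGraph d G →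
      ∀ π : PortAssignment G, ∃ F : Fin n → List Bool, IsShortestPathRouting π F ∧
        ∀ u, 2 * (F u).length ≤
          n * (Nat.log 2 n + (9 + 2 * Nat.log 2 (Nat.log 2 n * (Nat.log 2 n + d)))) := by
  classical
  obtain ⟨c₁, htypical⟩ := exists_isTypical_of_isRandomGraph
  obtain ⟨c₂, hrouting⟩ := exists_isShortestPathRouting
  refine ⟨3 * c₁ + 8 + c₂, fun n d hc hn G hG π => ?_⟩
  obtain ⟨hdegree, hcommon⟩ := htypical n d (by omega) hn G hG
  have hlt : n < 2 ^ (Nat.log 2 n + 1) := Nat.lt_pow_succ_log_self one_lt_two n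
  set L := Nat.log 2 n
  set M := L * (L + d)
  set K := Nat.log 2 M
  have hL : 0 < L := by omega
  have hMn : 2 * L ^ 2 * M ≤ n := by rwa [show 2 * L ^ 2 * M = 2 * L ^ 3 * (L + d) by ring]
  have hK : K ≤ L := Nat.log_mono_right ((Nat.le_mul_of_pos_left M (by positivity)).trans hMn)
  have hLn : 3 * L ≤ n := by
    have hLM : L * 1 ≤ M := Nat.mul_le_mul_left L (by omega)
    nlinarith
  obtain ⟨F, hF, hlength⟩ := hrouting n (L + 1) (K + 1) G π hlt.le fun u v huv =>
    (hcommon u v huv).imp fun w hw => ⟨hw.1, hw.2.trans (Nat.lt_pow_succ_log_self one_lt_two M)⟩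
  refine ⟨F, hF, fun u => ?_⟩
  have hports : 2 * (G.degree u * (L + 1)) ≤ n * (L + 3) := by
    refine Nat.le_of_mul_le_mul_left ?_ hL
    nlinarith [hdegree u]
  have := hlength u
  nlinarith

end RandomGraphRouting

section Asymptotics

/-- The function `f` grows more slowly than every positive power. -/
def IsSubpolynomial (f : ℕ → ℕ) : Prop :=
  ∀ a : ℝ, 0 < a → (fun n : ℕ => (f n : ℝ)) =o[atTop] fun n : ℕ => (n : ℝ) ^ a

theorem isSubpolynomial_of_isBigO_logb {f : ℕ → ℕ}
    (hf : (fun n : ℕ => (f n : ℝ)) =O[atTop] fun n : ℕ => Real.logb 2 n) : IsSubpolynomial f := by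
  intro a ha
  have hlogb : (fun n : ℕ => Real.logb 2 n) =O[atTop] fun n : ℕ => Real.log n :=
    (isBigO_refl _ _).const_mul_left (Real.log 2)⁻¹ |>.congr_left fun n => by
      rw [Real.logb, inv_mul_eq_div]
  exact (hf.trans hlogb).trans_isLittleO
    ((isLittleO_log_rpow_atTop ha).comp_tendsto tendsto_natCast_atTop_atTop)

theorem isSubpolynomial_log : IsSubpolynomial (Nat.log 2) :=
  isSubpolynomial_of_isBigO_logb <| .of_bound' <| .of_forall fun n => by
    rw [Real.norm_natCast]
    exact (Real.natLog_le_logb n 2).trans (Real.le_norm_self _)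

namespace IsSubpolynomial

variable {f g : ℕ → ℕ}

theorem add (hf : IsSubpolynomial f) (hg : IsSubpolynomial g) :
    IsSubpolynomial fun n => f n + g n := fun a ha => by
  simpa using (hf a ha).add (hg a ha)

theorem mul (hf : IsSubpolynomial f) (hg : IsSubpolynomial g) :
    IsSubpolynomial fun n => f n * g n := fun a ha => by
  refine ((hf (a / 2) (half_pos ha)).mul (hg (a / 2) (half_pos ha))).congr (fun n => by simp)
    fun n => ?_
  rw [← Real.rpow_add_of_nonneg n.cast_nonneg (half_pos ha).le (half_pos ha).le, add_halves]

theorem eventually_le_rpow (hf : IsSubpolynomial f) {a : ℝ} (ha : 0 < a) :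
    ∀ᶠ n : ℕ in atTop, (f n : ℝ) ≤ (n : ℝ) ^ a := by
  filter_upwards [(hf a ha).bound one_pos] with n hn
  rwa [Real.norm_natCast, Real.norm_of_nonneg (by positivity), one_mul] at hn

theorem eventually_mul_le (hf : IsSubpolynomial f) (k : ℕ) : ∀ᶠ n in atTop, k * f n ≤ n := by
  filter_upwards [((hf 1 one_pos).const_mul_left k).bound one_pos] with n hn
  have : (k * f n : ℝ) ≤ n := by simpa using hn
  exact_mod_cast this

theorem log_isLittleO_log (hf : IsSubpolynomial f) :
    (fun n : ℕ => (Nat.log 2 (f n) : ℝ)) =o[atTop] fun n : ℕ => (Nat.log 2 n : ℝ) := by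
  refine IsLittleO.of_bound fun c hc => ?_
  filter_upwards [hf.eventually_le_rpow (half_pos hc), eventually_ge_atTop 2] with n hn hn2
  have hL : (1 : ℝ) ≤ Nat.log 2 n := by exact_mod_cast Nat.log_pos one_lt_two hn2
  have hlogb : Real.logb 2 n ≤ Nat.log 2 n + 1 := by
    rw [Real.logb_le_iff_le_rpow one_lt_two (by positivity)]
    exact_mod_cast (Nat.lt_pow_succ_log_self one_lt_two n).le
  rw [Real.norm_natCast, Real.norm_natCast]
  rcases Nat.eq_zero_or_pos (f n) with h0 | hpos
  · simp only [h0, Nat.log_zero_right, Nat.cast_zero]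
    positivity
  calc (Nat.log 2 (f n) : ℝ) ≤ Real.logb 2 (f n) := Real.natLog_le_logb _ _
    _ ≤ Real.logb 2 ((n : ℝ) ^ (c / 2)) :=
      Real.logb_le_logb_of_le one_lt_two (by exact_mod_cast hpos) hn
    _ = c / 2 * Real.logb 2 n := Real.logb_rpow_eq_mul_logb_of_pos (by positivity)
    _ ≤ c / 2 * (Nat.log 2 n + Nat.log 2 n) := by gcongr; linarith
    _ = c * Nat.log 2 n := by ring

end IsSubpolynomial

theorem tendsto_log_two_atTop : Tendsto (Nat.log 2) atTop atTop :=
  tendsto_atTop.2 fun b => (eventually_ge_atTop (2 ^ b)).mono fun _ hn =>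
    Nat.le_log_of_pow_le one_lt_two hn

theorem tendsto_add_log_div_log {f : ℕ → ℕ} (hf : IsSubpolynomial f) (a b : ℕ) :
    Tendsto (fun n : ℕ => ((a + b * Nat.log 2 (f n) : ℕ) : ℝ) / Nat.log 2 n) atTop (𝓝 0) := by
  have hconst : (fun _ => (a : ℝ)) =o[atTop] fun n : ℕ => (Nat.log 2 n : ℝ) :=
    isLittleO_const_left.2 <| .inr <| tendsto_norm_atTop_atTop.comp <|
      tendsto_natCast_atTop_atTop.comp tendsto_log_two_atTop
  push_cast
  exact (hconst.add (hf.log_isLittleO_log.const_mul_left b)).tendsto_div_nhds_zero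

theorem cast_le_half_mul_logb_mul {n k a : ℕ} (hn : 0 < Nat.log 2 n)
    (hk : 2 * k ≤ n * (Nat.log 2 n + a)) :
    (k : ℝ) ≤ n / 2 * Real.logb 2 n * (1 + a / Nat.log 2 n) := by
  have hk' : (2 * k : ℝ) ≤ n * (Nat.log 2 n + a) := by exact_mod_cast hk
  calc (k : ℝ) ≤ n / 2 * (Nat.log 2 n + a) := by linarith
    _ = n / 2 * Nat.log 2 n * (1 + a / Nat.log 2 n) := by field_simp
    _ ≤ n / 2 * Real.logb 2 n * (1 + a / Nat.log 2 n) := by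
      gcongr
      exact Real.natLog_le_logb n 2

end Asymptotics

end CompactRouting

theorem mainTheorem4_general (δ : ℕ → ℕ) (hδ : CompactRouting.IsSubpolynomial δ) :
    ∃ ε : ℕ → ℝ, Tendsto ε atTop (𝓝 0) ∧
      ∀ᶠ n : ℕ in atTop, ∀ G : SimpleGraph (Fin n), CompactRouting.IsRandomGraph (δ n) G →
        ∀ π : CompactRouting.PortAssignment G,
          ∃ F : Fin n → List Bool, CompactRouting.IsShortestPathRouting π F ∧
            (∀ u : Fin n, ((F u).length : ℝ) ≤ (n : ℝ) / 2 * Real.logb 2 n * (1 + ε n)) ∧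
            ((∑ u : Fin n, (F u).length : ℕ) : ℝ) ≤
              (n : ℝ) ^ 2 / 2 * Real.logb 2 n * (1 + ε n) := by
  obtain ⟨c, hrouting⟩ := CompactRouting.exists_isShortestPathRouting_of_isRandomGraph
  have hlog := CompactRouting.isSubpolynomial_log
  refine ⟨_, CompactRouting.tendsto_add_log_div_log (hlog.mul (hlog.add hδ)) 9 2, ?_⟩
  filter_upwards [CompactRouting.tendsto_log_two_atTop.eventually_ge_atTop (c + 1),
    ((hlog.mul (hlog.mul hlog)).mul (hlog.add hδ)).eventually_mul_le 2] with n hc hn G hG π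
  obtain ⟨F, hF, hlength⟩ := hrouting n (δ n) (by omega) (by convert hn using 1; ring) G hG π
  have hnode := fun u =>
    CompactRouting.cast_le_half_mul_logb_mul (lt_of_lt_of_le c.succ_pos hc) (hlength u)
  refine ⟨F, hF, hnode, ?_⟩
  rw [Nat.cast_sum]
  refine (Finset.sum_le_card_nsmul _ _ _ fun u _ => hnode u).trans_eq ?_
  rw [Finset.card_univ, Fintype.card_fin, nsmul_eq_mul]
  ring

theorem mainTheorem4 (δ : ℕ → ℕ)
    (hδ : (fun n : ℕ => (δ n : ℝ)) =O[atTop] fun n : ℕ => Real.logb 2 n) :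
    ∃ ε : ℕ → ℝ, Tendsto ε atTop (𝓝 0) ∧
      ∀ᶠ n : ℕ in atTop, ∀ G : SimpleGraph (Fin n), CompactRouting.IsRandomGraph (δ n) G →
        ∀ π : CompactRouting.PortAssignment G,
          ∃ F : Fin n → List Bool, CompactRouting.IsShortestPathRouting π F ∧
            (∀ u : Fin n, ((F u).length : ℝ) ≤ (n : ℝ) / 2 * Real.logb 2 n * (1 + ε n)) ∧
            ((∑ u : Fin n, (F u).length : ℕ) : ℝ) ≤
              (n : ℝ) ^ 2 / 2 * Real.logb 2 n * (1 + ε n) :=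
  mainTheorem4_general δ (CompactRouting.isSubpolynomial_of_isBigO_logb hδ)
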